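/- Let $(\mathsf X,\rho)$ be a complete separable metric space with its Borel $\sigma$-algebra. For Borel probability measures $\mu,\nu$ on $\mathsf X$ let $$W_1(\mu,\nu)=\inf_{\upsilon}\int_{\mathsf X\times\mathsf X}\rho(x,y)\,\upsilon(\mathrm dx,\mathrm dy)\in[0,\infty],$$ the infimum being over all couplings $\upsilon$ of $\mu$ and $\nu$ (probability measures on $\mathsf X\times\mathsf X$ with marginals $\mu$ and $\nu$). For a Markov kernel $P$ on $\mathsf X$ let $\operatorname{Ric}(P)$ be the supremum of all $\kappa\in(0,1]$ such that $W_1(P(\cdot|x),P(\cdot|y))\le(1-\kappa)\rho(x,y)$ for all $x,y\in\mathsf X$ (and $\operatorname{Ric}(P)=0$ if there is no such $\kappa$). For $f:\mathsf X\to\mathbb R$ let $\|f\|_{\rm Lip}=\sup_{x\ne y}|f(x)-f(y)|/\rho(x,y)$. Let $P_1,P_2,\ldots$ be Markov kernels on $\mathsf X$, and for each $t\ge1$ let $\pi_t$ be a probability measure that is invariant under $P_t$. Let $T\in\{0,1,2,\ldots\}\cup\{\infty\}$, let $\delta_t\ge0$ be real numbers with $W_1(\pi_t,\pi_{t+1})\le\delta_t$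 for all integers $1\le t\le T$, and let $\kappa^\star\in(0,1)$ be such that $\operatorname{Ric}(P_t)\ge\kappa^\star$ for all $t\ge1$. Let $\mu_1$ be a probability measure on $\mathsf X$ and put $\mu_{t+1}=\mu_tP_t$, i.e. $\mu_{t+1}(A)=\int P_t(A|x)\,\mu_t(\mathrm dx)$, for $t\ge1$. Then for every integer $t$ with $1\le t\le T+1$ (for every $t\ge1$ if $T=\infty$), $$W_1(\mu_t,\pi_t)\le B_t:=(1-\kappa^\star)^{t-1}W_1(\mu_1,\pi_1)+\sum_{s=1}^{t-1}(1-\kappa^\star)^{t-1-s}\delta_s,$$ where the sum is empty for $t=1$. Moreover, for every such $t$ and every Lipschitz function $f:\mathsf X\to\mathbb R$: if $W_1(\mu_1,\pi_1)<\infty$, then $f$ is $\mu_t$-integrable if and only if it is $\pi_t$-integrable; and whenever $f$ is integrable under both $\mu_t$ and $\pi_t$, $$\Big|\int_{\mathsf X}f\,\mathrm d\mu_t-\int_{\mathsf X}f\,\mathrm d\pi_t\Big|\le\|f\|_{\rm Lip}\,B_t,$$ with the convention $0\cdot\infty=0$. -/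

import Mathlib

open MeasureTheory ProbabilityTheory
open scoped ENNReal

/-- `υ` is a coupling of `μ` and `ν`: a probability measure on `X × X` with these marginals. -/
structure IsCoupling {X : Type*} [MeasurableSpace X] (υ : Measure (X × X)) (μ ν : Measure X) :
    Prop where
  isProbabilityMeasure : IsProbabilityMeasure υ
  map_fst : υ.map Prod.fst = μ
  map_snd : υ.map Prod.snd = ν

/-- The `L¹` Wasserstein distance: the infimum over all couplings of the expected distance.
It takes values in `[0, ∞]`, because no moments are assumed. -/
noncomputable def wassersteinOne {X : Type*} [MetricSpace X] [MeasurableSpace X]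
    (μ ν : Measure X) : ℝ≥0∞ :=
  ⨅ (υ : Measure (X × X)) (_ : IsCoupling υ μ ν), ∫⁻ p, edist p.1 p.2 ∂υ

/-- The Ricci curvature of a Markov kernel: the supremum of all `κ ∈ (0, 1]` such that
`W₁(P(·|x), P(·|y)) ≤ (1 - κ) ρ(x, y)` for all `x, y`. If there is no such `κ`, the value is `0`. -/
noncomputable def ricciCurvature {X : Type*} [MetricSpace X] [MeasurableSpace X]
    (P : Kernel X X) : ℝ :=
  sSup {κ : ℝ | 0 < κ ∧ κ ≤ 1 ∧
    ∀ x y : X, wassersteinOne (P x) (P y) ≤ ENNReal.ofReal (1 - κ) * edist x y}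

/-- The Lipschitz constant `sup_{x ≠ y} |f x - f y| / ρ(x, y)` of a real-valued function, in
`[0, ∞]`. -/
noncomputable def lipConst {X : Type*} [MetricSpace X] (f : X → ℝ) : ℝ≥0∞ :=
  ⨆ (x : X) (y : X) (_ : x ≠ y), ENNReal.ofReal (|f x - f y| / dist x y)

/-- The right-hand side of the tracking bound at time `t ≥ 1`; the sum is empty for `t = 1`. -/
noncomputable def trackingBound (κ : ℝ) (δ : ℕ → ℝ) (w : ℝ≥0∞) (t : ℕ) : ℝ≥0∞ :=
  ENNReal.ofReal ((1 - κ) ^ (t - 1)) * w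
    + ENNReal.ofReal (∑ s ∈ Finset.Ico 1 t, (1 - κ) ^ (t - 1 - s) * δ s)

open Filter Topology
open scoped NNReal

/-! ### Couplings and the triangle inequality. -/

section Coupling

variable {X : Type*} [MetricSpace X] [MeasurableSpace X]

/-! Invariance turns W₁(μ_{t+1}, π_t) into W₁(μ_t P_t, π_t P_t), which is at most (1 - κ) W₁(μ_t,
π_t). The triangle inequality then adds the drift δ_t, and unrolling this recursion gives B_t. The
test-function bound is the easy half of Kantorovich duality: integrate f(x) - f(y) against
couplings.

The work lies in extending contraction from point masses to all measures (`wassersteinOne_bind_le`),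
which naively needs couplings of P(·|x) and P(·|y) chosen measurably in (x, y). Rounding points to a
countable dense set leaves only countably many couplings to choose. As the mesh shrinks, the images
under the rounded kernel converge weakly (`tendsto_of_coe_eq_comap_comp`), and W₁ is weakly lower
semicontinuous (`wassersteinOne_le_of_tendsto`). -/

theorem IsCoupling.wassersteinOne_le {υ : Measure (X × X)} {μ ν : Measure X}
    (h : IsCoupling υ μ ν) : wassersteinOne μ ν ≤ ∫⁻ p, edist p.1 p.2 ∂υ :=
  iInf₂_le υ h

theorem exists_isCoupling_lintegral_lt {μ ν : Measure X} {c : ℝ≥0∞}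
    (h : wassersteinOne μ ν < c) :
    ∃ υ : Measure (X × X), IsCoupling υ μ ν ∧ ∫⁻ p, edist p.1 p.2 ∂υ < c := by
  simpa [wassersteinOne, iInf_lt_iff] using h

/-- Gluing of couplings along their common marginal. -/
theorem wassersteinOne_triangle [CompleteSpace X] [TopologicalSpace.SeparableSpace X]
    [BorelSpace X] (μ ν ρ : Measure X) :
    wassersteinOne μ ρ ≤ wassersteinOne μ ν + wassersteinOne ν ρ := by
  have : SecondCountableTopology X := UniformSpace.secondCountable_of_separable X
  have key : ∀ υ₁, IsCoupling υ₁ μ ν → ∀ υ₂, IsCoupling υ₂ ν ρ →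
      wassersteinOne μ ρ ≤ ∫⁻ p, edist p.1 p.2 ∂υ₁ + ∫⁻ p, edist p.1 p.2 ∂υ₂ := by
    intro υ₁ h₁ υ₂ h₂
    have := h₁.isProbabilityMeasure
    have := h₂.isProbabilityMeasure
    have : Nonempty X := by
      obtain ⟨x⟩ := υ₁.nonempty_of_neZero
      exact ⟨x.1⟩
    -- Given (x, y) drawn from υ₁, the third point z follows the conditional law of υ₂ given y.
    let K : Kernel (X × X) X := υ₂.condKernel.comap Prod.snd measurable_snd
    let τ : Measure ((X × X) × X) := υ₁ ⊗ₘ K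
    have hτ₁ : τ.map Prod.fst = υ₁ := Measure.fst_compProd υ₁ K
    have hτ₂ : τ.map (fun p ↦ (p.1.2, p.2)) = υ₂ := by
      have hm : Measurable (fun p : (X × X) × X ↦ (p.1.2, p.2)) := by fun_prop
      ext s hs
      rw [Measure.map_apply hm hs, Measure.compProd_apply (hm hs)]
      conv_rhs => rw [← υ₂.disintegrate υ₂.condKernel, Measure.compProd_apply hs]
      have : υ₂.fst = υ₁.map Prod.snd := by rw [h₁.map_snd, ← h₂.map_fst, Measure.fst]
      rw [this, lintegral_map (Kernel.measurable_kernel_prodMk_left hs) measurable_snd]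
      rfl
    have hc : IsCoupling (τ.map fun p ↦ (p.1.1, p.2)) μ ρ := by
      refine ⟨Measure.isProbabilityMeasure_map (by fun_prop), ?_, ?_⟩
      · rw [Measure.map_map (by fun_prop) (by fun_prop), ← h₁.map_fst, ← hτ₁,
          Measure.map_map (by fun_prop) (by fun_prop)]
        rfl
      · rw [Measure.map_map (by fun_prop) (by fun_prop), ← h₂.map_snd, ← hτ₂,
          Measure.map_map (by fun_prop) (by fun_prop)]
        rfl
    refine hc.wassersteinOne_le.trans ?_
    rw [lintegral_map (by fun_prop) (by fun_prop), ← hτ₁, ← hτ₂,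
      lintegral_map (by fun_prop) (by fun_prop), lintegral_map (by fun_prop) (by fun_prop),
      ← lintegral_add_left (by fun_prop)]
    exact lintegral_mono fun p ↦ edist_triangle _ _ _
  refine ENNReal.le_of_forall_pos_le_add fun ε hε hfin ↦ ?_
  have hε' : (ε / 2 : ℝ≥0∞) ≠ 0 := by simpa using hε.ne'
  obtain ⟨υ₁, h₁, h₁'⟩ := exists_isCoupling_lintegral_lt
    (ENNReal.lt_add_right (ENNReal.add_lt_top.1 hfin).1.ne hε')
  obtain ⟨υ₂, h₂, h₂'⟩ := exists_isCoupling_lintegral_lt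
    (ENNReal.lt_add_right (ENNReal.add_lt_top.1 hfin).2.ne hε')
  refine (key υ₁ h₁ υ₂ h₂).trans ((add_le_add h₁'.le h₂'.le).trans ?_)
  rw [add_add_add_comm, ENNReal.add_halves]

end Coupling

/-! ### Lipschitz test functions against couplings. -/

section Lipschitz

variable {X : Type*} [MetricSpace X]

theorem ofReal_abs_sub_le_lipConst_mul (f : X → ℝ) (x y : X) :
    ENNReal.ofReal |f x - f y| ≤ lipConst f * edist x y := by
  rcases eq_or_ne x y with rfl | hxy
  · simp
  have h : ENNReal.ofReal (|f x - f y| / dist x y) ≤ lipConst f :=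
    le_iSup_of_le x (le_iSup_of_le y (le_iSup_of_le hxy le_rfl))
  calc ENNReal.ofReal |f x - f y| = ENNReal.ofReal (|f x - f y| / dist x y * dist x y) := by
        rw [div_mul_cancel₀ _ (dist_ne_zero.2 hxy)]
    _ = ENNReal.ofReal (|f x - f y| / dist x y) * edist x y := by
        rw [ENNReal.ofReal_mul (by positivity), edist_dist]
    _ ≤ lipConst f * edist x y := by gcongr

theorem LipschitzWith.lipConst_le {f : X → ℝ} {K : ℝ≥0} (hf : LipschitzWith K f) :
    lipConst f ≤ K := by
  refine iSup_le fun x ↦ iSup_le fun y ↦ iSup_le fun hxy ↦ ?_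
  refine ENNReal.ofReal_le_of_le_toReal ?_
  rw [ENNReal.coe_toReal, div_le_iff₀ (dist_pos.2 hxy), ← Real.dist_eq]
  exact hf.dist_le_mul x y

variable [MeasurableSpace X]

theorem IsCoupling.ofReal_abs_integral_sub_le [SecondCountableTopology X] [BorelSpace X]
    {υ : Measure (X × X)} {μ ν : Measure X}
    (h : IsCoupling υ μ ν) {f : X → ℝ} (hμ : Integrable f μ) (hν : Integrable f ν) :
    ENNReal.ofReal |∫ x, f x ∂μ - ∫ x, f x ∂ν| ≤ lipConst f * ∫⁻ p, edist p.1 p.2 ∂υ := by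
  have h₁ : Integrable (fun p : X × X ↦ f p.1) υ := by
    rw [← h.map_fst] at hμ
    exact hμ.comp_measurable measurable_fst
  have h₂ : Integrable (fun p : X × X ↦ f p.2) υ := by
    rw [← h.map_snd] at hν
    exact hν.comp_measurable measurable_snd
  have e₁ : ∫ x, f x ∂μ = ∫ p, f p.1 ∂υ := by
    rw [← h.map_fst] at hμ ⊢
    exact integral_map measurable_fst.aemeasurable hμ.aestronglyMeasurable
  have e₂ : ∫ x, f x ∂ν = ∫ p, f p.2 ∂υ := by
    rw [← h.map_snd] at hν ⊢
    exact integral_map measurable_snd.aemeasurable hν.aestronglyMeasurable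
  rw [e₁, e₂, ← integral_sub h₁ h₂, ← Real.enorm_eq_ofReal_abs]
  refine (enorm_integral_le_lintegral_enorm _).trans ?_
  refine (lintegral_mono fun p ↦ ?_).trans_eq (lintegral_const_mul _ (by fun_prop))
  simpa [Real.enorm_eq_ofReal_abs] using ofReal_abs_sub_le_lipConst_mul f p.1 p.2

theorem ofReal_abs_integral_sub_le_wassersteinOne [SecondCountableTopology X] [BorelSpace X]
    {μ ν : Measure X} [IsProbabilityMeasure μ] [IsProbabilityMeasure ν]
    {f : X → ℝ} (hf : ∃ K, LipschitzWith K f) (hμ : Integrable f μ) (hν : Integrable f ν) :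
    ENNReal.ofReal |∫ x, f x ∂μ - ∫ x, f x ∂ν| ≤ lipConst f * wassersteinOne μ ν := by
  obtain ⟨K, hK⟩ := hf
  have hfin : lipConst f ≠ ∞ := (hK.lipConst_le.trans_lt ENNReal.coe_lt_top).ne
  -- W₁ may be infinite, so 0 · ∞ = 0 must be covered: for constant f any coupling will do, for
  -- instance the product.
  rcases eq_or_ne (lipConst f) 0 with h0 | h0
  · have hprod : IsCoupling (μ.prod ν) μ ν :=
      ⟨inferInstance, by simp,
        by simp⟩
    simpa [h0] using hprod.ofReal_abs_integral_sub_le hμ hν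
  · rw [mul_comm, ← ENNReal.div_le_iff_le_mul (.inl h0) (.inl hfin), wassersteinOne]
    refine le_iInf₂ fun υ hυ ↦ ?_
    rw [ENNReal.div_le_iff_le_mul (.inl h0) (.inl hfin), mul_comm]
    exact hυ.ofReal_abs_integral_sub_le hμ hν

/-- Under the coupling, f(x) - f(y) is dominated by K ρ(x, y), hence integrable. -/
theorem IsCoupling.integrable_iff [SecondCountableTopology X] [BorelSpace X]
    {υ : Measure (X × X)} {μ ν : Measure X} (h : IsCoupling υ μ ν)
    (hfin : ∫⁻ p, edist p.1 p.2 ∂υ ≠ ∞) {f : X → ℝ} (hf : ∃ K, LipschitzWith K f) :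
    Integrable f μ ↔ Integrable f ν := by
  obtain ⟨K, hK⟩ := hf
  have hcf : Continuous f := hK.continuous
  have hd : Integrable (fun p : X × X ↦ f p.1 - f p.2) υ := by
    refine ⟨by fun_prop, ?_⟩
    rw [hasFiniteIntegral_iff_enorm]
    calc ∫⁻ p, ‖f p.1 - f p.2‖ₑ ∂υ ≤ ∫⁻ p, K * edist p.1 p.2 ∂υ :=
          lintegral_mono fun p ↦ by rw [← edist_eq_enorm_sub]; exact hK p.1 p.2
      _ = K * ∫⁻ p, edist p.1 p.2 ∂υ := lintegral_const_mul _ (by fun_prop)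
      _ < ∞ := ENNReal.mul_lt_top ENNReal.coe_lt_top hfin.lt_top
  rw [← h.map_fst, ← h.map_snd,
    integrable_map_measure hcf.aestronglyMeasurable measurable_fst.aemeasurable,
    integrable_map_measure hcf.aestronglyMeasurable measurable_snd.aemeasurable]
  constructor <;> intro hi
  · exact (hi.sub hd).congr (.of_forall fun p ↦ sub_sub_cancel _ _)
  · exact (hi.add hd).congr (.of_forall fun p ↦ add_sub_cancel _ _)

theorem integrable_iff_of_wassersteinOne_ne_top [SecondCountableTopology X] [BorelSpace X]
    {μ ν : Measure X} (h : wassersteinOne μ ν ≠ ∞) {f : X → ℝ} (hf : ∃ K, LipschitzWith K f) :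
    Integrable f μ ↔ Integrable f ν := by
  obtain ⟨υ, hυ, hlt⟩ := exists_isCoupling_lintegral_lt h.lt_top
  exact hυ.integrable_iff hlt.ne hf

end Lipschitz

/-! ### Weak lower semicontinuity of the transport cost. -/

section Semicontinuity

variable {X : Type*} [MetricSpace X] [CompleteSpace X] [SecondCountableTopology X]
  [MeasurableSpace X] [BorelSpace X]

/-- A convergent sequence together with its limit is compact, so the converse half of Prokhorov's
theorem applies. -/
theorem isTightMeasureSet_range_of_tendsto {α : ℕ → ProbabilityMeasure X}
    {α' : ProbabilityMeasure X} (h : Tendsto α atTop (𝓝 α')) :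
    IsTightMeasureSet (Set.range fun n ↦ (α n : Measure X)) := by
  have hc : IsCompact (closure (Set.range α)) :=
    h.isCompact_insert_range.of_isClosed_subset isClosed_closure
      (closure_minimal (Set.subset_insert _ _) h.isCompact_insert_range.isClosed)
  refine (isTightMeasureSet_of_isCompact_closure hc).subset ?_
  rintro _ ⟨n, rfl⟩
  exact ⟨α n, ⟨n, rfl⟩, rfl⟩

/-- Lower semicontinuity of the transport cost under weak convergence of the marginals. -/
theorem wassersteinOne_le_of_tendsto {α β : ℕ → ProbabilityMeasure X}
    {α' β' : ProbabilityMeasure X} (hα : Tendsto α atTop (𝓝 α')) (hβ : Tendsto β atTop (𝓝 β'))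
    {c : ℕ → ℝ≥0∞} {c' : ℝ≥0∞} (hc : Tendsto c atTop (𝓝 c'))
    (h : ∀ n, wassersteinOne (α n : Measure X) (β n) < c n) :
    wassersteinOne (α' : Measure X) β' ≤ c' := by
  choose υ hυ hcost using fun n ↦ exists_isCoupling_lintegral_lt (h n)
  let Υ : ℕ → ProbabilityMeasure (X × X) := fun n ↦ ⟨υ n, (hυ n).isProbabilityMeasure⟩
  -- Couplings with tight marginals are tight. Prokhorov's theorem then gives a limit coupling,
  -- taken along an ultrafilter instead of a subsequence.
  have htight : IsTightMeasureSet {((m : ProbabilityMeasure (X × X)) : Measure (X × X)) |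
      m ∈ Set.range Υ} := by
    refine IsTightMeasureSet.prodMk
      ((isTightMeasureSet_range_of_tendsto hα).subset ?_)
      ((isTightMeasureSet_range_of_tendsto hβ).subset ?_)
    · rintro _ ⟨_, ⟨_, ⟨n, rfl⟩, rfl⟩, rfl⟩
      exact ⟨n, (hυ n).map_fst.symm⟩
    · rintro _ ⟨_, ⟨_, ⟨n, rfl⟩, rfl⟩, rfl⟩
      exact ⟨n, (hυ n).map_snd.symm⟩
  let F : Ultrafilter ℕ := hyperfilter ℕ
  have hF : (F : Filter ℕ) ≤ atTop := Nat.hyperfilter_le_atTop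
  obtain ⟨υ', -, hυ'⟩ := (isCompact_closure_of_isTightMeasureSet htight).ultrafilter_le_nhds
    (F.map Υ) (by
      rw [le_principal_iff]
      exact mem_map.2 (univ_mem' fun n ↦ subset_closure ⟨n, rfl⟩))
  have hlim : Tendsto Υ F (𝓝 υ') := hυ'
  have hfst : υ'.map measurable_fst.aemeasurable = α' := by
    refine tendsto_nhds_unique
      (ProbabilityMeasure.tendsto_map_of_tendsto_of_continuous _ _ hlim continuous_fst)
      ((hα.mono_left hF).congr fun n ↦ ?_)
    exact Subtype.ext (hυ n).map_fst.symm
  have hsnd : υ'.map measurable_snd.aemeasurable = β' := by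
    refine tendsto_nhds_unique
      (ProbabilityMeasure.tendsto_map_of_tendsto_of_continuous _ _ hlim continuous_snd)
      ((hβ.mono_left hF).congr fun n ↦ ?_)
    exact Subtype.ext (hυ n).map_snd.symm
  have hcoup : IsCoupling (υ' : Measure (X × X)) α' β' :=
    ⟨inferInstance, congrArg Subtype.val hfst, congrArg Subtype.val hsnd⟩
  refine hcoup.wassersteinOne_le.trans ?_
  -- The distance is unbounded, so weak convergence is applied to its truncations at M, which
  -- increase to it.
  let g : ℕ → X × X → ℝ≥0 := fun M p ↦ min (nndist p.1 p.2) M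
  have hgc : ∀ M, Continuous (g M) := fun M ↦ by fun_prop
  have hgle : ∀ M p, (g M p : ℝ≥0∞) ≤ edist p.1 p.2 := fun M p ↦ by
    rw [edist_nndist]
    exact_mod_cast min_le_left _ _
  have hsup : ∀ p : X × X, edist p.1 p.2 = ⨆ M, (g M p : ℝ≥0∞) := fun p ↦ by
    refine le_antisymm ?_ (iSup_le fun M ↦ hgle M p)
    obtain ⟨M, hM⟩ := exists_nat_ge (nndist p.1 p.2)
    refine le_iSup_of_le M ?_
    rw [edist_nndist]
    exact_mod_cast le_min le_rfl hM
  calc ∫⁻ p, edist p.1 p.2 ∂(υ' : Measure (X × X))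
      = ∫⁻ p, ⨆ M, (g M p : ℝ≥0∞) ∂(υ' : Measure (X × X)) := by simp_rw [hsup]
    _ = ⨆ M, ∫⁻ p, (g M p : ℝ≥0∞) ∂(υ' : Measure (X × X)) := by
        refine lintegral_iSup (fun M ↦ (hgc M).measurable.coe_nnreal_ennreal) fun M N hMN p ↦ ?_
        have : (M : ℝ≥0) ≤ N := by exact_mod_cast hMN
        exact ENNReal.coe_le_coe.2 (min_le_min_left _ this)
    _ ≤ c' := iSup_le fun M ↦ by
        let gb : BoundedContinuousFunction (X × X) ℝ≥0 :=
          BoundedContinuousFunction.mkOfBound ⟨g M, hgc M⟩ M fun p q ↦ by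
            rw [NNReal.dist_eq, abs_le]
            have h₁ : (g M p : ℝ) ≤ M := by exact_mod_cast min_le_right _ _
            have h₂ : (g M q : ℝ) ≤ M := by exact_mod_cast min_le_right _ _
            have h₃ := (g M p).coe_nonneg
            have h₄ := (g M q).coe_nonneg
            constructor <;> simp only [ContinuousMap.coe_mk] <;> linarith
        have ht := ProbabilityMeasure.tendsto_iff_forall_lintegral_tendsto.1 hlim gb
        refine le_of_tendsto_of_tendsto' ht (hc.mono_left hF) fun n ↦ ?_
        exact (lintegral_mono fun p ↦ hgle M p).trans (hcost n).le

end Semicontinuity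

/-! ### From contraction at points to contraction at measures. -/

section Contraction

variable {X : Type*} [MetricSpace X] [MeasurableSpace X]

theorem wassersteinOne_le_of_le_ricciCurvature {P : Kernel X X} {κ : ℝ} (hκ : 0 < κ)
    (h : κ ≤ ricciCurvature P) (x y : X) :
    wassersteinOne (P x) (P y) ≤ ENNReal.ofReal (1 - κ) * edist x y := by
  set S : Set ℝ := {κ : ℝ | 0 < κ ∧ κ ≤ 1 ∧
    ∀ x y : X, wassersteinOne (P x) (P y) ≤ ENNReal.ofReal (1 - κ) * edist x y} with hS
  -- An empty set would have supremum 0 < κ. The supremum need not be assumed attained: the bound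
  -- holds for every a < κ and passes to the limit.
  have hne : S.Nonempty := by
    rw [Set.nonempty_iff_ne_empty]
    intro hempty
    have : ricciCurvature P = sSup S := rfl
    rw [this, hempty, Real.sSup_empty] at h
    exact absurd h hκ.not_ge
  have hlt : ∀ a < κ, wassersteinOne (P x) (P y) ≤ ENNReal.ofReal (1 - a) * edist x y := by
    intro a ha
    obtain ⟨b, ⟨-, -, hb⟩, hab⟩ := exists_lt_of_lt_csSup hne (ha.trans_le h)
    exact (hb x y).trans (by gcongr)
  have ht : Tendsto (fun a : ℝ ↦ ENNReal.ofReal (1 - a) * edist x y) (𝓝[<] κ)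
      (𝓝 (ENNReal.ofReal (1 - κ) * edist x y)) := by
    refine tendsto_nhdsWithin_of_tendsto_nhds (ENNReal.Tendsto.mul_const ?_
      (.inr (edist_ne_top x y)))
    exact ENNReal.tendsto_ofReal (tendsto_const_nhds.sub tendsto_id)
  exact ge_of_tendsto ht (eventually_nhdsWithin_of_forall hlt)

variable [BorelSpace X]

theorem exists_measurable_index_edist_lt (a : ℕ → X) (ha : DenseRange a) {ε : ℝ≥0∞}
    (hε : 0 < ε) : ∃ g : X → ℕ, Measurable g ∧ ∀ x, edist x (a (g x)) < ε := by
  classical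
  have hex : ∀ x, ∃ n, edist x (a n) < ε := fun x ↦ by
    obtain ⟨_, ⟨n, rfl⟩, hn⟩ := EMetric.mem_closure_iff.1 (ha x) ε hε
    exact ⟨n, hn⟩
  refine ⟨fun x ↦ Nat.find (hex x), measurable_find hex fun n ↦ ?_, fun x ↦ Nat.find_spec (hex x)⟩
  exact (isOpen_lt (by fun_prop) continuous_const).measurableSet

variable [SecondCountableTopology X]

/-- Bounded Lipschitz functions determine weak convergence, and moving x by at most ε changes ∫ f
dP(·|x) by at most K c ε. -/
theorem tendsto_of_coe_eq_comap_comp {P : Kernel X X} [IsMarkovKernel P] {c : ℝ≥0} (hP : ∀ x y,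
    wassersteinOne (P x) (P y) ≤ c * edist x y) {μ : Measure X} [IsProbabilityMeasure μ]
    {h : ℕ → X → X} (hm : ∀ n, Measurable (h n)) {ε : ℕ → ℝ≥0} (hε : Tendsto ε atTop (𝓝 0))
    (hh : ∀ n x, edist x (h n x) ≤ ε n) {α : ℕ → ProbabilityMeasure X} {α' : ProbabilityMeasure X}
    (hα : ∀ n, (α n : Measure X) = (P.comap (h n) (hm n)) ∘ₘ μ) (hα' : (α' : Measure X) = P ∘ₘ μ) :
    Tendsto α atTop (𝓝 α') := by
  rw [tendsto_iff_forall_lipschitz_integral_tendsto]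
  rintro f ⟨C, hC⟩ ⟨K, hK⟩
  have hint : ∀ m : Measure X, [IsProbabilityMeasure m] → Integrable f m := fun m _ ↦ by
    have : Nonempty X := m.nonempty_of_neZero
    obtain ⟨x₀⟩ := this
    refine Integrable.of_bound hK.continuous.aestronglyMeasurable (‖f x₀‖ + C)
      (.of_forall fun x ↦ ?_)
    have := hC x x₀
    rw [dist_eq_norm] at this
    linarith [norm_sub_norm_le (f x) (f x₀)]
  have hcomp : ∀ Q : Kernel X X, [IsMarkovKernel Q] →
      ∫ x, f x ∂(Q ∘ₘ μ) = ∫ x, ∫ y, f y ∂Q x ∂μ := fun Q _ ↦ by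
    have hi := hint (Q ∘ₘ μ)
    rw [Measure.comp_eq_comp_const_apply] at hi ⊢
    rw [Kernel.integral_comp hi, Kernel.const_apply]
  have hint' : ∀ Q : Kernel X X, [IsMarkovKernel Q] → Integrable (fun x ↦ ∫ y, f y ∂Q x) μ :=
      fun Q _ ↦ by
    have hi := hint (Q ∘ₘ μ)
    rw [Measure.comp_eq_comp_const_apply] at hi
    simpa using hi.integral_comp
  have hpt : ∀ n x, |∫ y, f y ∂P (h n x) - ∫ y, f y ∂P x| ≤ K * c * ε n := fun n x ↦ by
    have h₁ := ofReal_abs_integral_sub_le_wassersteinOne ⟨K, hK⟩ (hint (P (h n x))) (hint (P x))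
    have h₂ : lipConst f * wassersteinOne (P (h n x)) (P x) ≤ ((K * c * ε n : ℝ≥0) : ℝ≥0∞) := by
      calc lipConst f * wassersteinOne (P (h n x)) (P x) ≤ K * (c * ε n) := by
            gcongr
            · exact hK.lipConst_le
            · refine (hP _ _).trans ?_
              rw [edist_comm]
              gcongr
              exact hh n x
        _ = ((K * c * ε n : ℝ≥0) : ℝ≥0∞) := by push_cast; ring
    have h₃ := h₁.trans h₂
    rw [ENNReal.ofReal_le_coe] at h₃
    exact_mod_cast h₃
  rw [tendsto_iff_dist_tendsto_zero]
  refine squeeze_zero (fun _ ↦ dist_nonneg) (g := fun n ↦ (K * c * ε n : ℝ)) (fun n ↦ ?_) ?_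
  · rw [hα n, hα', hcomp, hcomp, dist_eq_norm, ← integral_sub (hint' _) (hint' _)]
    simpa using norm_integral_le_of_norm_le_const (μ := μ)
      (f := fun x ↦ ∫ y, f y ∂P (h n x) - ∫ y, f y ∂P x) (.of_forall (hpt n))
  · have : Tendsto (fun n ↦ (ε n : ℝ)) atTop (𝓝 0) := by
      rw [← NNReal.coe_zero]
      exact NNReal.tendsto_coe.2 hε
    simpa using this.const_mul (K * c : ℝ)

/-- A kernel contracting the Wasserstein distance between point masses contracts it between
arbitrary probability measures. The points are discretized, so that no measurable selection of
couplings is needed, and the discretization is removed by lower semicontinuity. -/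
theorem wassersteinOne_bind_le [CompleteSpace X] {P : Kernel X X} [IsMarkovKernel P] {c : ℝ≥0} (hc₀ : c ≠ 0)
    (hP : ∀ x y, wassersteinOne (P x) (P y) ≤ c * edist x y)
    (μ ν : Measure X) :
    wassersteinOne (μ.bind P) (ν.bind P) ≤ c * wassersteinOne μ ν := by
  rw [mul_comm, ← ENNReal.div_le_iff_le_mul (by simp [hc₀]) (by simp)]
  refine le_iInf₂ fun υ hυ ↦ ?_
  rw [ENNReal.div_le_iff_le_mul (by simp [hc₀]) (by simp), mul_comm]
  have := hυ.isProbabilityMeasure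
  have hμ : IsProbabilityMeasure μ :=
    hυ.map_fst ▸ Measure.isProbabilityMeasure_map measurable_fst.aemeasurable
  have hν : IsProbabilityMeasure ν :=
    hυ.map_snd ▸ Measure.isProbabilityMeasure_map measurable_snd.aemeasurable
  have : Nonempty X := μ.nonempty_of_neZero
  obtain ⟨a, ha⟩ := TopologicalSpace.exists_dense_seq X
  obtain ⟨ε, -, hε₀, hε⟩ := exists_seq_strictAnti_tendsto (0 : ℝ≥0)
  choose g hgm hg using fun n ↦ exists_measurable_index_edist_lt a ha
    (ENNReal.coe_pos.2 (hε₀ n))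
  have hm : ∀ n, Measurable fun x ↦ a (g n x) := fun n ↦ (measurable_from_nat).comp (hgm n)
  have hsel : ∀ n, ∀ p : ℕ × ℕ, ∃ τ : Measure (X × X), IsCoupling τ (P (a p.1)) (P (a p.2)) ∧
      ∫⁻ q, edist q.1 q.2 ∂τ < c * edist (a p.1) (a p.2) + ε n := fun n p ↦
    exists_isCoupling_lintegral_lt ((hP _ _).trans_lt (ENNReal.lt_add_right
      (ENNReal.mul_ne_top ENNReal.coe_ne_top (edist_ne_top _ _)) (by simpa using (hε₀ n).ne')))
  choose τ hτ hτc using hsel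
  -- The selected coupling depends only on a pair of indices, so measurability is automatic.
  let C : ℕ → Kernel (X × X) (X × X) := fun n ↦
    { toFun := fun p ↦ τ n (g n p.1, g n p.2)
      measurable' := (measurable_of_countable (τ n)).comp
        (((hgm n).comp measurable_fst).prodMk ((hgm n).comp measurable_snd)) }
  have hCM : ∀ n, IsMarkovKernel (C n) := fun n ↦ ⟨fun p ↦ (hτ n _).isProbabilityMeasure⟩
  have hcoup : ∀ n, IsCoupling (C n ∘ₘ υ) ((P.comap _ (hm n)) ∘ₘ μ) ((P.comap _ (hm n)) ∘ₘ ν) := by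
    refine fun n ↦ ⟨inferInstance, ?_, ?_⟩
    · ext s hs
      rw [← hυ.map_fst, Measure.map_apply measurable_fst hs,
        Measure.bind_apply (measurable_fst hs) (C n).aemeasurable,
        Measure.bind_apply hs (Kernel.aemeasurable _),
        lintegral_map (Kernel.measurable_coe _ hs) measurable_fst]
      refine lintegral_congr fun p ↦ ?_
      rw [← Measure.map_apply measurable_fst hs]
      exact congrArg (· s) (hτ n _).map_fst
    · ext s hs
      rw [← hυ.map_snd, Measure.map_apply measurable_snd hs,
        Measure.bind_apply (measurable_snd hs) (C n).aemeasurable,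
        Measure.bind_apply hs (Kernel.aemeasurable _),
        lintegral_map (Kernel.measurable_coe _ hs) measurable_snd]
      refine lintegral_congr fun p ↦ ?_
      rw [← Measure.map_apply measurable_snd hs]
      exact congrArg (· s) (hτ n _).map_snd
  -- Rounding both endpoints costs 2ε, multiplied by c; the remaining ε is the near-optimality slack
  -- of τ.
  have hcost : ∀ n, ∫⁻ q, edist q.1 q.2 ∂(C n ∘ₘ υ) ≤
      c * ∫⁻ p, edist p.1 p.2 ∂υ + (2 * c + 1) * ε n := fun n ↦ by
    rw [Measure.lintegral_bind (C n).aemeasurable (by fun_prop)]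
    calc ∫⁻ p, ∫⁻ q, edist q.1 q.2 ∂(C n p) ∂υ
        ≤ ∫⁻ p, (c * edist p.1 p.2 + (2 * c + 1) * ε n) ∂υ := by
          refine lintegral_mono fun p ↦ (hτc n _).le.trans ?_
          have h₁ : edist (a (g n p.1)) (a (g n p.2)) ≤ ε n + edist p.1 p.2 + ε n := by
            refine (edist_triangle4 _ p.1 p.2 _).trans ?_
            gcongr
            · rw [edist_comm]; exact (hg n _).le
            · exact (hg n _).le
          calc (c : ℝ≥0∞) * edist (a (g n p.1)) (a (g n p.2)) + ε n
              ≤ c * (ε n + edist p.1 p.2 + ε n) + ε n := by gcongr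
            _ = c * edist p.1 p.2 + (2 * c + 1) * ε n := by ring
      _ = c * ∫⁻ p, edist p.1 p.2 ∂υ + (2 * c + 1) * ε n := by
          rw [lintegral_add_left (by fun_prop), lintegral_const_mul _ (by fun_prop)]
          simp
  rcases eq_or_ne (∫⁻ p, edist p.1 p.2 ∂υ) ∞ with htop | htop
  · simp [htop, hc₀]
  refine wassersteinOne_le_of_tendsto
    (α := fun n ↦ ⟨(P.comap _ (hm n)) ∘ₘ μ, inferInstance⟩) (α' := ⟨P ∘ₘ μ, inferInstance⟩)
    (β := fun n ↦ ⟨(P.comap _ (hm n)) ∘ₘ ν, inferInstance⟩) (β' := ⟨P ∘ₘ ν, inferInstance⟩)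
    (tendsto_of_coe_eq_comap_comp hP hm hε (fun n x ↦ (hg n x).le) (fun _ ↦ rfl) rfl)
    (tendsto_of_coe_eq_comap_comp hP hm hε (fun n x ↦ (hg n x).le) (fun _ ↦ rfl) rfl)
    (c := fun n ↦ c * ∫⁻ p, edist p.1 p.2 ∂υ + (2 * c + 1) * ε n + ε n) ?_ fun n ↦ ?_
  · have hε' : Tendsto (fun n ↦ (ε n : ℝ≥0∞)) atTop (𝓝 0) := by
      rw [← ENNReal.coe_zero]
      exact ENNReal.tendsto_coe.2 hε
    have h₁ := ENNReal.Tendsto.const_mul (a := (2 * c + 1 : ℝ≥0∞)) hε'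
      (.inr (by exact_mod_cast ENNReal.coe_ne_top (r := 2 * c + 1)))
    simpa using (tendsto_const_nhds.add h₁).add hε'
  · refine ((hcoup n).wassersteinOne_le.trans (hcost n)).trans_lt (ENNReal.lt_add_right ?_ ?_)
    · exact ENNReal.add_ne_top.2 ⟨ENNReal.mul_ne_top ENNReal.coe_ne_top htop,
        by exact_mod_cast ENNReal.coe_ne_top (r := (2 * c + 1) * ε n)⟩
    · simpa using (hε₀ n).ne'

end Contraction

/-! ### Recursion for the bound, and the tracking estimate. -/

theorem trackingBound_succ {κ : ℝ} (hκ : κ ≤ 1) {δ : ℕ → ℝ} (hδ : ∀ t, 1 ≤ t → 0 ≤ δ t)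
    (w : ℝ≥0∞) {t : ℕ} (ht : 1 ≤ t) :
    trackingBound κ δ w (t + 1) =
      ENNReal.ofReal (1 - κ) * trackingBound κ δ w t + ENNReal.ofReal (δ t) := by
  have hκ' : 0 ≤ 1 - κ := sub_nonneg.2 hκ
  obtain ⟨t, rfl⟩ := Nat.exists_eq_add_of_le' ht
  have hsum : 0 ≤ ∑ s ∈ Finset.Ico 1 (t + 1), (1 - κ) ^ (t - s) * δ s :=
    Finset.sum_nonneg fun s hs ↦ mul_nonneg (pow_nonneg hκ' _) (hδ s (Finset.mem_Ico.1 hs).1)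
  have hstep : ∑ s ∈ Finset.Ico 1 (t + 1 + 1), (1 - κ) ^ (t + 1 - s) * δ s =
      (1 - κ) * ∑ s ∈ Finset.Ico 1 (t + 1), (1 - κ) ^ (t - s) * δ s + δ (t + 1) := by
    rw [Finset.sum_Ico_succ_top (by omega), Finset.mul_sum]
    congr 1
    · refine Finset.sum_congr rfl fun s hs ↦ ?_
      have : t + 1 - s = (t - s) + 1 := by have := (Finset.mem_Ico.1 hs).2; omega
      rw [this]
      ring
    · simp
  simp only [trackingBound, Nat.add_sub_cancel]
  rw [hstep, ENNReal.ofReal_add (mul_nonneg hκ' hsum) (hδ _ (by omega)),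
    ENNReal.ofReal_mul hκ', pow_succ', ENNReal.ofReal_mul hκ', mul_add, mul_assoc, add_assoc]

theorem trackingBound_ne_top {κ : ℝ} {δ : ℕ → ℝ} {w : ℝ≥0∞} (hw : w ≠ ∞) (t : ℕ) :
    trackingBound κ δ w t ≠ ∞ :=
  ENNReal.add_ne_top.2 ⟨ENNReal.mul_ne_top ENNReal.ofReal_ne_top hw, ENNReal.ofReal_ne_top⟩

theorem lemma2 {X : Type*} [MetricSpace X] [CompleteSpace X] [TopologicalSpace.SeparableSpace X]
    [MeasurableSpace X] [BorelSpace X]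
    (P : ℕ → Kernel X X) [∀ t, IsMarkovKernel (P t)]
    (π : ℕ → Measure X) [∀ t, IsProbabilityMeasure (π t)]
    (hπ : ∀ t, 1 ≤ t → (P t).Invariant (π t))
    -- the horizon; `T = ⊤` is the case of all times `t ≥ 1`
    (T : ℕ∞)
    (δ : ℕ → ℝ) (hδ : ∀ t, 1 ≤ t → 0 ≤ δ t)
    (hstep : ∀ t : ℕ, 1 ≤ t → (t : ℕ∞) ≤ T →
      wassersteinOne (π t) (π (t + 1)) ≤ ENNReal.ofReal (δ t))
    (κ : ℝ) (hκ₀ : 0 < κ) (hκ₁ : κ < 1)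
    (hric : ∀ t, 1 ≤ t → κ ≤ ricciCurvature (P t))
    (μ : ℕ → Measure X) (hμ₁ : IsProbabilityMeasure (μ 1))
    (hμ : ∀ t, 1 ≤ t → μ (t + 1) = (μ t).bind (P t)) :
    ∀ t : ℕ, 1 ≤ t → (t : ℕ∞) ≤ T + 1 →
      wassersteinOne (μ t) (π t) ≤ trackingBound κ δ (wassersteinOne (μ 1) (π 1)) t ∧
      ∀ f : X → ℝ, (∃ K, LipschitzWith K f) →
        (wassersteinOne (μ 1) (π 1) ≠ ∞ → (Integrable f (μ t) ↔ Integrable f (π t))) ∧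
        (Integrable f (μ t) → Integrable f (π t) →
          ENNReal.ofReal |∫ x, f x ∂(μ t) - ∫ x, f x ∂(π t)|
            ≤ lipConst f * trackingBound κ δ (wassersteinOne (μ 1) (π 1)) t) := by
  have : SecondCountableTopology X := UniformSpace.secondCountable_of_separable X
  have hprob : ∀ t, 1 ≤ t → IsProbabilityMeasure (μ t) := fun t ht ↦ by
    induction t, ht using Nat.le_induction with
    | base => exact hμ₁
    | succ t ht ih => rw [hμ t ht]; infer_instance
  have hbound : ∀ t : ℕ, 1 ≤ t → (t : ℕ∞) ≤ T + 1 →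
      wassersteinOne (μ t) (π t) ≤ trackingBound κ δ (wassersteinOne (μ 1) (π 1)) t := by
    intro t ht
    induction t, ht using Nat.le_induction with
    | base => intro; simp [trackingBound]
    | succ t ht ih =>
      intro htT
      -- Reaching time t + 1 uses only the drifts up to δ_t, hence the range up to T + 1.
      have htT' : (t : ℕ∞) ≤ T := by
        push_cast at htT
        exact (ENat.add_le_add_iff_right (by simp)).1 htT
      rw [trackingBound_succ hκ₁.le hδ _ ht]
      refine (wassersteinOne_triangle _ (π t) _).trans (add_le_add ?_ (hstep t ht htT'))
      calc wassersteinOne (μ (t + 1)) (π t)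
          = wassersteinOne ((μ t).bind (P t)) ((π t).bind (P t)) := by
            rw [hμ t ht, (hπ t ht).def]
        _ ≤ ENNReal.ofReal (1 - κ) * wassersteinOne (μ t) (π t) :=
            wassersteinOne_bind_le (by simpa using hκ₁)
              (wassersteinOne_le_of_le_ricciCurvature hκ₀ (hric t ht)) _ _
        _ ≤ _ := by
            gcongr
            exact ih (htT'.trans le_self_add)
  intro t ht htT
  have := hprob t ht
  refine ⟨hbound t ht htT, fun f hf ↦ ⟨fun hw ↦ ?_, fun h₁ h₂ ↦ ?_⟩⟩
  · exact integrable_iff_of_wassersteinOne_ne_top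
      (ne_top_of_le_ne_top (trackingBound_ne_top hw t) (hbound t ht htT)) hf
  · refine (ofReal_abs_integral_sub_le_wassersteinOne hf h₁ h₂).trans ?_
    gcongr
    exact hbound t ht htT
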